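/- Let $\mathcal B$ be a finite set of real numbers with $\gamma=\min\mathcal B\ge 1$ and $\Gamma=\max\mathcal B>\gamma$, and let $s>0$. For $\beta\in\mathcal B$ put $\theta_\beta(x)=1/(x+\beta)$, and let $$(L_sf)(x)=\sum_{\beta\in\mathcal B}|\theta_\beta'(x)|^s f(\theta_\beta(x)).$$ Fix $\mathfrak b_0\ge 1/\gamma$ (for instance $\mathfrak b_0=1/\gamma$ or $\mathfrak b_0=1$), let $\mathfrak a_0=0$, and define $\mathfrak a_{k+1}=\theta_\Gamma(\mathfrak b_k)$, $\mathfrak b_{k+1}=\theta_\gamma(\mathfrak a_k)$ for integers $k\ge 0$. Then the limits $\mathfrak a_\infty=\lim_k\mathfrak a_k>0$ and $\mathfrak b_\infty=\lim_k\mathfrak b_k$ exist, and for $0\le k\le\infty$ one has $\mathfrak a_k<\mathfrak b_k$, the intervals $[\mathfrak a_k,\mathfrak b_k]$ decrease as $k$ increases, and each is mapped into itself by every $\theta_\beta$. For every $0\le l\le\infty$ the operator $L_s$ on $C([\mathfrak a_l,\mathfrak b_l])$ has a strictly positive eigenfunction $v_s$, and it is unique up to multiplication by a positive constant. Let $0\le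 l\le k\le\infty$ and let $v_s$ be the strictly positive eigenfunction of $L_s$ on $[\mathfrak a_l,\mathfrak b_l]$ (the case $l=0$ being that of the whole interval $[\mathfrak a_0,\mathfrak b_0]$). Then $v_s$ is $C^\infty$ on $[\mathfrak a_l,\mathfrak b_l]$, and: (1) for all integers $j\ge1$ and all $x\in[\mathfrak a_k,\mathfrak b_k]$, $$\frac{(2s)(2s+1)\cdots(2s+j-1)}{(\mathfrak b_k+\mathfrak a_\infty^{-1})^j}\le\frac{(-1)^j v_s^{(j)}(x)}{v_s(x)}\le\frac{(2s)(2s+1)\cdots(2s+j-1)}{(\mathfrak a_k+\mathfrak b_\infty^{-1})^j};$$ (2) with $\chi=\mathfrak a_k+\mathfrak b_\infty^{-1}$, for all $x_1,x_2\in[\mathfrak a_k,\mathfrak b_k]$, $$v_s(x_1)\le v_s(x_2)\exp(2s|x_1-x_2|/\chi),$$ that is, $\ln v_s$ is Lipschitz on $[\mathfrak a_k,\mathfrak b_k]$ with constant $2s/\chi$. -/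

import Mathlib

open Filter Topology
open scoped ContDiff

noncomputable section

/-- The continued-fraction branch `θ_β(x) = 1 / (x + β)`. -/
def cfMap (β x : ℝ) : ℝ := 1 / (x + β)

/-- The pair `(a_n, b_n)` defined by `a_0 = 0`, `b_0 = b₀`, `a_{n+1} = θ_Γ(b_n)` and
`b_{n+1} = θ_γ(a_n)`. -/
def cfEndpoints (γ Γ b₀ : ℝ) : ℕ → ℝ × ℝ
  | 0 => (0, b₀)
  | n + 1 => (cfMap Γ (cfEndpoints γ Γ b₀ n).2, cfMap γ (cfEndpoints γ Γ b₀ n).1)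

/-- The left endpoint `a_k` for `0 ≤ k ≤ ∞`, where `a_∞` is the limit of the `a_n`. -/
def cfLeft (γ Γ b₀ : ℝ) (k : ℕ∞) : ℝ :=
  ENat.recTopCoe (C := fun _ => ℝ) (limUnder atTop fun n : ℕ => (cfEndpoints γ Γ b₀ n).1)
    (fun n : ℕ => (cfEndpoints γ Γ b₀ n).1) k

/-- The right endpoint `b_k` for `0 ≤ k ≤ ∞`, where `b_∞` is the limit of the `b_n`. -/
def cfRight (γ Γ b₀ : ℝ) (k : ℕ∞) : ℝ :=
  ENat.recTopCoe (C := fun _ => ℝ) (limUnder atTop fun n : ℕ => (cfEndpoints γ Γ b₀ n).2)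
    (fun n : ℕ => (cfEndpoints γ Γ b₀ n).2) k

/-- The interval `[a_k, b_k]` for `0 ≤ k ≤ ∞`. -/
def cfInterval (γ Γ b₀ : ℝ) (k : ℕ∞) : Set ℝ :=
  Set.Icc (cfLeft γ Γ b₀ k) (cfRight γ Γ b₀ k)

/-- The transfer operator `(L_s f)(x) = ∑_{β ∈ B} |θ_β'(x)|^s f(θ_β(x))`. -/
def cfTransfer (B : Finset ℝ) (s : ℝ) (f : ℝ → ℝ) (x : ℝ) : ℝ :=
  ∑ β ∈ B, |deriv (cfMap β) x| ^ s * f (cfMap β x)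

/-- `v` restricts to a continuous, strictly positive eigenfunction of `L_s` on `S`; the values
of `v` outside `S` are irrelevant when every `θ_β` maps `S` into itself. -/
structure IsPosEigenfunction (B : Finset ℝ) (s : ℝ) (S : Set ℝ) (v : ℝ → ℝ) : Prop where
  continuousOn : ContinuousOn v S
  pos : ∀ x ∈ S, 0 < v x
  eigen : ∃ lam : ℝ, ∀ x ∈ S, cfTransfer B s v x = lam * v x

end

/-! The kernel `(1 + r x) ^ (-2s)` is symmetric for the transfer operator: since `(x + β)(1 + r
θ_β(x)) = x + β + r = (r + β)(1 + x θ_β(r))`, applying `L_s` in `x` or in `r` gives the same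
function. Hence if `ν` is an eigenmeasure of the adjoint of `L_s` on `[a_∞, b_∞]`, then `x ↦ ∫ (1 +
r x) ^ (-2s) dν(r)` is a positive eigenfunction on every `[a_l, b_l]` at once
(`exists_eigen_moment`).

Differentiating under the integral, `(-1)^j v^(j)` is `2s(2s+1)⋯(2s+j-1)` times the integral of the
same kernel divided by `(x + 1/r)^j`. As `r` ranges over `[a_∞, b_∞]` and `x` over `[a_k, b_k]`, the
number `x + 1/r` lies between `a_k + 1/b_∞` and `b_k + 1/a_∞`, which gives (1) (`cfMoment_bounds`).
The same pointwise control of the kernel gives (2) (`cfMoment_le_mul_exp`).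

The eigenmeasure comes from Hahn-Banach separation at a Collatz-Wielandt value
(`exists_critical_value`) and Riesz representation. A maximum principle for the quotient of two
positive eigenfunctions, together with the contraction `θ_Γ`, gives uniqueness
(`eigenfunction_unique`), so every positive eigenfunction is a multiple of the integral above. -/

/-! ### Eigenmeasures of positive operators on `C(X)`. -/

section PositiveOperator

variable {X : Type*} [TopologicalSpace X] [CompactSpace X]

/-- The critical value of a positive operator, below which no strict supersolution exists. -/
theorem exists_critical_value [Nonempty X] (T : C(X, ℝ) →ₗ[ℝ] C(X, ℝ))
    (hT : ∀ f : C(X, ℝ), (∀ x, 0 ≤ f x) → ∀ x, 0 ≤ T f x) :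
    ∃ lam : ℝ, ∀ f : C(X, ℝ), ∃ x, lam * f x ≤ T f x := by
  set M : Set ℝ := {μ | ∃ ψ : C(X, ℝ), (∀ x, 0 < ψ x) ∧ ∀ x, T ψ x < μ * ψ x} with hM
  have hne : M.Nonempty := by
    refine ⟨‖T 1‖ + 1, 1, fun x => by simp, fun x => ?_⟩
    have := (le_abs_self _).trans ((T 1).norm_coe_le_norm x)
    simp only [ContinuousMap.one_apply, mul_one]
    linarith
  have hbdd : BddBelow M := by
    refine ⟨0, ?_⟩
    rintro μ ⟨ψ, hψ, hμ⟩
    obtain ⟨x⟩ := ‹Nonempty X›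
    have h1 := (hT ψ (fun x => (hψ x).le) x).trans_lt (hμ x)
    exact (pos_of_mul_pos_left h1 (hψ x).le).le
  refine ⟨sInf M, fun φ => ?_⟩
  by_contra! hφ
  set lam := sInf M
  obtain ⟨xm, -, hxm⟩ := isCompact_univ.exists_isMinOn Set.univ_nonempty
    (f := fun x => lam * φ x - T φ x) (by fun_prop)
  obtain ⟨ε, hε, hε'⟩ : ∃ ε > 0, ∀ x, T φ x + ε ≤ lam * φ x := by
    refine ⟨lam * φ xm - T φ xm, by linarith [hφ xm], fun x => ?_⟩
    have := hxm (Set.mem_univ x)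
    simp only [Set.mem_ofPred_eq] at this
    linarith
  have hK : ∀ x, |φ x| ≤ ‖φ‖ := fun x => φ.norm_coe_le_norm x
  set K := ‖φ‖
  have hK0 : 0 ≤ K := norm_nonneg _
  -- With `δ = ε / (K + 1)`, moving the eigenvalue by `δ` costs at most `δ K < ε`, less than the gap
  -- in the strict inequality for `φ`.
  have hδ : 0 < ε / (K + 1) := by positivity
  have hδK : ε / (K + 1) * K < ε := by
    rw [div_mul_eq_mul_div, div_lt_iff₀ (by positivity)]
    nlinarith
  -- If `φ > 0`, it is itself a witness that `lam - δ` lies in `M`, below the infimum.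
  by_cases hpos : ∀ x, 0 < φ x
  · have hmem : lam - ε / (K + 1) ∈ M := by
      refine ⟨φ, hpos, fun x => ?_⟩
      have h1 := hε' x
      have h2 : ε / (K + 1) * φ x ≤ ε / (K + 1) * K := by
        gcongr
        exact (le_abs_self _).trans (hK x)
      nlinarith
    have := csInf_le hbdd hmem
    linarith
  · push Not at hpos
    obtain ⟨y, hy⟩ := hpos
    -- Otherwise correct `φ` by a positive `ψ` with `lam ≤ μ < lam + δ`.
    obtain ⟨μ, ⟨ψ, hψ, hμψ⟩, hμ⟩ := exists_lt_of_csInf_lt hne (lt_add_of_pos_right lam hδ)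
    have hlm : lam ≤ μ := csInf_le hbdd ⟨ψ, hψ, hμψ⟩
    obtain ⟨x₀, -, hx₀⟩ := isCompact_univ.exists_isMaxOn Set.univ_nonempty
      (f := fun x => -φ x / ψ x)
      (Continuous.continuousOn (by
        have : ∀ x, ψ x ≠ 0 := fun x => (hψ x).ne'
        fun_prop (disch := assumption)))
    -- The least `c` with `φ + c ψ ≥ 0`; this sum vanishes at `x₀`. Positivity of `T` gives `0 ≤ T
    -- (φ + c ψ) x₀`, while the strict inequalities bound it by `(μ - lam)(-φ x₀) - ε < 0`.
    set c := -φ x₀ / ψ x₀ with hc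
    have hcx : ∀ x, -φ x / ψ x ≤ c := fun x => hx₀ (Set.mem_univ x)
    have hc0 : 0 ≤ c := le_trans (div_nonneg (by linarith) (hψ y).le) (hcx y)
    have hceq : c * ψ x₀ = -φ x₀ := by
      rw [hc, div_mul_cancel₀ _ (hψ x₀).ne']
    have hg : ∀ x, 0 ≤ (φ + c • ψ) x := by
      intro x
      have := (div_le_iff₀ (hψ x)).1 (hcx x)
      simp only [ContinuousMap.add_apply, ContinuousMap.smul_apply, smul_eq_mul]
      linarith
    have h1 := hT _ hg x₀
    rw [map_add, map_smul] at h1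
    simp only [ContinuousMap.add_apply, ContinuousMap.smul_apply, smul_eq_mul] at h1
    have h2 := mul_le_mul_of_nonneg_left (hμψ x₀).le hc0
    have h3 := hε' x₀
    have h4 : c * (μ * ψ x₀) = -μ * φ x₀ := by
      rw [mul_left_comm, hceq]; ring
    have h5 : (μ - lam) * (-φ x₀) ≤ ε / (K + 1) * K := by
      apply mul_le_mul (by linarith) ((neg_le_abs _).trans (hK x₀)) _ hδ.le
      rw [← hceq]
      exact mul_nonneg hc0 (hψ x₀).le
    nlinarith

/-- The adjoint of a positive operator on `C(X, ℝ)` has a positive eigenfunctional. -/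
theorem exists_positive_eigenfunctional [Nonempty X] (T : C(X, ℝ) →ₗ[ℝ] C(X, ℝ))
    (hT : ∀ f : C(X, ℝ), (∀ x, 0 ≤ f x) → ∀ x, 0 ≤ T f x) :
    ∃ (lam : ℝ) (Λ : C(X, ℝ) →L[ℝ] ℝ), (∀ f : C(X, ℝ), (∀ x, 0 ≤ f x) → 0 ≤ Λ f) ∧
      0 < Λ 1 ∧ ∀ f, Λ (T f) = lam * Λ f := by
  obtain ⟨lam, hlam⟩ := exists_critical_value T hT
  set R := LinearMap.range (T - lam • LinearMap.id)
  have hopen : IsOpen {g : C(X, ℝ) | ∀ x, 0 < g x} := by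
    simpa [Set.MapsTo] using
      ContinuousMap.isOpen_setOfPred_mapsTo (X := X) isCompact_univ (isOpen_Ioi (a := (0 : ℝ)))
  have hconv : Convex ℝ {g : C(X, ℝ) | ∀ x, 0 < g x} := by
    intro f hf g hg a b ha hb hab x
    simp only [ContinuousMap.add_apply, ContinuousMap.smul_apply, smul_eq_mul]
    exact (convex_Ioi (0 : ℝ)) (hf x) (hg x) ha hb hab
  have hdisj : Disjoint {g : C(X, ℝ) | ∀ x, 0 < g x} (R : Set C(X, ℝ)) := by
    rw [Set.disjoint_left]
    rintro g hg ⟨ψ, rfl⟩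
    -- The sign change turns the critical inequality into `T ψ x - lam * ψ x ≤ 0` at some `x`, so
    -- the range of `T - lam` misses the open positive cone.
    obtain ⟨x, hx⟩ := hlam (-ψ)
    have := hg x
    simp at this hx
    linarith
  obtain ⟨f, u, hf, hu⟩ := geometric_hahn_banach_open hconv hopen R.convex hdisj
  have hu0 : u ≤ 0 := by simpa using hu 0 R.zero_mem
  have hpos : ∀ g : C(X, ℝ), (∀ x, 0 < g x) → 0 < -f g := fun g hg => by
    linarith [hf g hg]
  have h1 : 0 < -f 1 := hpos 1 (fun x => by simp)
  have hzero : ∀ b ∈ R, f b = 0 := by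
    intro b hb
    by_contra hne
    -- A functional bounded below on a subspace vanishes there: this multiple of `b` would take the
    -- value `u - 1 < u`.
    have := hu (((u - 1) / f b) • b) (R.smul_mem _ hb)
    rw [map_smul, smul_eq_mul, div_mul_cancel₀ _ hne] at this
    linarith
  refine ⟨lam, -f, fun g hg => ?_, by simpa using h1, fun g => ?_⟩
  · by_contra! hlt
    simp only [neg_apply] at hlt
    -- If `-f g < 0`, this strictly positive shift of `g` is sent to exactly `0` by `-f`.
    have := hpos (g + (f g / (-f 1)) • 1) (fun x => by
      have : 0 < f g / (-f 1) := div_pos (by linarith) h1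
      simp only [ContinuousMap.add_apply, ContinuousMap.smul_apply, ContinuousMap.one_apply,
        smul_eq_mul, mul_one]
      linarith [hg x])
    rw [map_add, map_smul, smul_eq_mul] at this
    have h2 : f g / (-f 1) * f 1 = - f g := by
      have : f 1 ≠ 0 := by linarith
      field_simp
    rw [h2] at this
    linarith
  · have := hzero (T g - lam • g) ⟨g, by simp⟩
    simp [sub_eq_zero] at this
    simp [this]

/-- The adjoint of a positive operator on `C(X, ℝ)` has a nonzero eigenmeasure. -/
theorem exists_eigenmeasure [Nonempty X] [T2Space X] [MeasurableSpace X] [BorelSpace X]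
    (T : C(X, ℝ) →ₗ[ℝ] C(X, ℝ))
    (hT : ∀ f : C(X, ℝ), (∀ x, 0 ≤ f x) → ∀ x, 0 ≤ T f x) :
    ∃ (lam : ℝ) (ν : MeasureTheory.Measure X), MeasureTheory.IsFiniteMeasure ν ∧ ν ≠ 0 ∧
      ∀ f : C(X, ℝ), ∫ x, T f x ∂ν = lam * ∫ x, f x ∂ν := by
  obtain ⟨lam, Λ, hΛ, h1, heig⟩ := exists_positive_eigenfunctional T hT
  let Λ' : CompactlySupportedContinuousMap X ℝ →ₚ[ℝ] ℝ :=
    PositiveLinearMap.mk₀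
      { toFun := fun f => Λ f.toContinuousMap
        map_add' := fun f g => map_add Λ f.toContinuousMap g.toContinuousMap
        map_smul' := fun c f => map_smul Λ c f.toContinuousMap }
      (fun f hf => hΛ f.toContinuousMap hf)
  have key : ∀ f : C(X, ℝ), ∫ x, f x ∂(RealRMK.rieszMeasure Λ') = Λ f := fun f =>
    RealRMK.integral_rieszMeasure Λ' (CompactlySupportedContinuousMap.continuousMapEquiv f)
  refine ⟨lam, RealRMK.rieszMeasure Λ', ?_, ?_, fun f => ?_⟩
  · infer_instance
  · intro h0
    have := key 1
    rw [h0] at this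
    simp at this
    linarith
  · rw [key, key, heig]

end PositiveOperator

/-! ### The nested invariant intervals. -/

section Endpoints

variable {γ Γ b₀ : ℝ}

theorem cfEndpoints_spec (hγ1 : 1 ≤ γ) (hγΓ : γ < Γ) (hb₀ : 1 / γ ≤ b₀) (n : ℕ) :
    0 ≤ (cfEndpoints γ Γ b₀ n).1 ∧ (cfEndpoints γ Γ b₀ n).1 < (cfEndpoints γ Γ b₀ n).2 ∧
    (cfEndpoints γ Γ b₀ n).1 ≤ (cfEndpoints γ Γ b₀ (n + 1)).1 ∧
    (cfEndpoints γ Γ b₀ (n + 1)).2 ≤ (cfEndpoints γ Γ b₀ n).2 := by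
  induction n with
  | zero =>
    have h0 : 0 < 1 / γ := by positivity
    have h1 : 0 < b₀ := h0.trans_le hb₀
    refine ⟨le_rfl, h1, ?_, by simpa [cfEndpoints, cfMap] using hb₀⟩
    simp only [cfEndpoints, cfMap]
    have : 0 < b₀ + Γ := by linarith
    positivity
  | succ n ih =>
    obtain ⟨h1, h2, h3, h4⟩ := ih
    have e1 : (cfEndpoints γ Γ b₀ (n + 1)).1 = 1 / ((cfEndpoints γ Γ b₀ n).2 + Γ) := rfl
    have e2 : (cfEndpoints γ Γ b₀ (n + 1)).2 = 1 / ((cfEndpoints γ Γ b₀ n).1 + γ) := rfl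
    have e3 : (cfEndpoints γ Γ b₀ (n + 1 + 1)).1 =
      1 / ((cfEndpoints γ Γ b₀ (n + 1)).2 + Γ) := rfl
    have e4 : (cfEndpoints γ Γ b₀ (n + 1 + 1)).2 =
      1 / ((cfEndpoints γ Γ b₀ (n + 1)).1 + γ) := rfl
    have h5 : 0 < (cfEndpoints γ Γ b₀ (n + 1)).2 := by
      rw [e2]; have : 0 < (cfEndpoints γ Γ b₀ n).1 + γ := by linarith
      positivity
    refine ⟨h1.trans h3, ?_, ?_, ?_⟩
    · rw [e1, e2]
      apply one_div_lt_one_div_of_lt <;> linarith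
    · rw [e3, e1]
      apply one_div_le_one_div_of_le <;> linarith
    · rw [e4, e2]
      apply one_div_le_one_div_of_le <;> linarith

@[simp] theorem cfLeft_natCast (n : ℕ) : cfLeft γ Γ b₀ n = (cfEndpoints γ Γ b₀ n).1 := by
  simp [cfLeft]

@[simp] theorem cfRight_natCast (n : ℕ) : cfRight γ Γ b₀ n = (cfEndpoints γ Γ b₀ n).2 := by
  simp [cfRight]

theorem monotone_fst_cfEndpoints (hγ1 : 1 ≤ γ) (hγΓ : γ < Γ) (hb₀ : 1 / γ ≤ b₀) :
    Monotone fun n => (cfEndpoints γ Γ b₀ n).1 :=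
  monotone_nat_of_le_succ fun n => (cfEndpoints_spec hγ1 hγΓ hb₀ n).2.2.1

theorem antitone_snd_cfEndpoints (hγ1 : 1 ≤ γ) (hγΓ : γ < Γ) (hb₀ : 1 / γ ≤ b₀) :
    Antitone fun n => (cfEndpoints γ Γ b₀ n).2 :=
  antitone_nat_of_succ_le fun n => (cfEndpoints_spec hγ1 hγΓ hb₀ n).2.2.2

theorem tendsto_cfLeft (hγ1 : 1 ≤ γ) (hγΓ : γ < Γ) (hb₀ : 1 / γ ≤ b₀) :
    Tendsto (fun n : ℕ => cfLeft γ Γ b₀ n) atTop (𝓝 (cfLeft γ Γ b₀ ⊤)) := by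
  simp only [cfLeft_natCast]
  refine tendsto_nhds_limUnder ⟨_, tendsto_atTop_ciSup
    (monotone_fst_cfEndpoints hγ1 hγΓ hb₀) ⟨b₀, ?_⟩⟩
  rintro _ ⟨n, rfl⟩
  exact (cfEndpoints_spec hγ1 hγΓ hb₀ n).2.1.le.trans
    (antitone_snd_cfEndpoints hγ1 hγΓ hb₀ n.zero_le)

theorem tendsto_cfRight (hγ1 : 1 ≤ γ) (hγΓ : γ < Γ) (hb₀ : 1 / γ ≤ b₀) :
    Tendsto (fun n : ℕ => cfRight γ Γ b₀ n) atTop (𝓝 (cfRight γ Γ b₀ ⊤)) := by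
  simp only [cfRight_natCast]
  refine tendsto_nhds_limUnder ⟨_, tendsto_atTop_ciInf
    (antitone_snd_cfEndpoints hγ1 hγΓ hb₀) ⟨0, ?_⟩⟩
  rintro _ ⟨n, rfl⟩
  exact (cfEndpoints_spec hγ1 hγΓ hb₀ n).1.trans (cfEndpoints_spec hγ1 hγΓ hb₀ n).2.1.le

theorem cfLeft_mono (hγ1 : 1 ≤ γ) (hγΓ : γ < Γ) (hb₀ : 1 / γ ≤ b₀) :
    Monotone (cfLeft γ Γ b₀) := by
  intro l k hlk
  induction k using ENat.recTopCoe with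
  | top =>
    induction l using ENat.recTopCoe with
    | top => exact le_rfl
    | coe n =>
      refine Monotone.ge_of_tendsto ?_ (tendsto_cfLeft hγ1 hγΓ hb₀) n
      simpa using monotone_fst_cfEndpoints hγ1 hγΓ hb₀
  | coe m =>
    lift l to ℕ using ne_top_of_le_ne_top (ENat.natCast_ne_top m) hlk
    simpa using monotone_fst_cfEndpoints hγ1 hγΓ hb₀ (ENat.natCast_le_natCast.1 hlk)

theorem cfRight_anti (hγ1 : 1 ≤ γ) (hγΓ : γ < Γ) (hb₀ : 1 / γ ≤ b₀) :
    Antitone (cfRight γ Γ b₀) := by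
  intro l k hlk
  induction k using ENat.recTopCoe with
  | top =>
    induction l using ENat.recTopCoe with
    | top => exact le_rfl
    | coe n =>
      refine Antitone.le_of_tendsto ?_ (tendsto_cfRight hγ1 hγΓ hb₀) n
      simpa using antitone_snd_cfEndpoints hγ1 hγΓ hb₀
  | coe m =>
    lift l to ℕ using ne_top_of_le_ne_top (ENat.natCast_ne_top m) hlk
    simpa using antitone_snd_cfEndpoints hγ1 hγΓ hb₀ (ENat.natCast_le_natCast.1 hlk)

theorem cfLeft_nonneg (hγ1 : 1 ≤ γ) (hγΓ : γ < Γ) (hb₀ : 1 / γ ≤ b₀) (k : ℕ∞) :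
    0 ≤ cfLeft γ Γ b₀ k := by
  have := cfLeft_mono hγ1 hγΓ hb₀ (zero_le : 0 ≤ k)
  rwa [← Nat.cast_zero, cfLeft_natCast] at this

theorem cfRight_top_nonneg (hγ1 : 1 ≤ γ) (hγΓ : γ < Γ) (hb₀ : 1 / γ ≤ b₀) :
    0 ≤ cfRight γ Γ b₀ ⊤ := by
  refine ge_of_tendsto' (tendsto_cfRight hγ1 hγΓ hb₀) fun n => ?_
  have h := cfEndpoints_spec hγ1 hγΓ hb₀ n
  simpa using h.1.trans h.2.1.le

theorem cfLeft_top_eq (hγ1 : 1 ≤ γ) (hγΓ : γ < Γ) (hb₀ : 1 / γ ≤ b₀) :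
    cfLeft γ Γ b₀ ⊤ = cfMap Γ (cfRight γ Γ b₀ ⊤) := by
  have h1 := (tendsto_add_atTop_iff_nat 1).2 (tendsto_cfLeft hγ1 hγΓ hb₀)
  refine tendsto_nhds_unique h1 ?_
  have h2 := cfRight_top_nonneg hγ1 hγΓ hb₀
  simp only [cfLeft_natCast]
  have h3 := tendsto_cfRight hγ1 hγΓ hb₀
  simp only [cfRight_natCast] at h3
  exact tendsto_const_nhds.div (h3.add_const Γ) (by linarith)

theorem cfRight_top_eq (hγ1 : 1 ≤ γ) (hγΓ : γ < Γ) (hb₀ : 1 / γ ≤ b₀) :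
    cfRight γ Γ b₀ ⊤ = cfMap γ (cfLeft γ Γ b₀ ⊤) := by
  have h1 := (tendsto_add_atTop_iff_nat 1).2 (tendsto_cfRight hγ1 hγΓ hb₀)
  refine tendsto_nhds_unique h1 ?_
  have h2 := cfLeft_nonneg hγ1 hγΓ hb₀ ⊤
  simp only [cfRight_natCast]
  have h3 := tendsto_cfLeft hγ1 hγΓ hb₀
  simp only [cfLeft_natCast] at h3
  exact tendsto_const_nhds.div (h3.add_const γ) (by linarith)

theorem cfLeft_top_pos (hγ1 : 1 ≤ γ) (hγΓ : γ < Γ) (hb₀ : 1 / γ ≤ b₀) :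
    0 < cfLeft γ Γ b₀ ⊤ := by
  rw [cfLeft_top_eq hγ1 hγΓ hb₀, cfMap]
  have := cfRight_top_nonneg hγ1 hγΓ hb₀
  exact one_div_pos.2 (by linarith)

/-- The limit only preserves `≤`. Strictness at `⊤` is recovered from the equations `a_∞ =
θ_Γ(b_∞)`, `b_∞ = θ_γ(a_∞)` and `γ < Γ`. -/
theorem cfLeft_lt_cfRight (hγ1 : 1 ≤ γ) (hγΓ : γ < Γ) (hb₀ : 1 / γ ≤ b₀) (k : ℕ∞) :
    cfLeft γ Γ b₀ k < cfRight γ Γ b₀ k := by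
  induction k using ENat.recTopCoe with
  | top =>
    have hle : cfLeft γ Γ b₀ ⊤ ≤ cfRight γ Γ b₀ ⊤ :=
      le_of_tendsto_of_tendsto' (tendsto_cfLeft hγ1 hγΓ hb₀) (tendsto_cfRight hγ1 hγΓ hb₀)
        fun n => by simpa using (cfEndpoints_spec hγ1 hγΓ hb₀ n).2.1.le
    have h0 := cfLeft_nonneg hγ1 hγΓ hb₀ ⊤
    calc cfLeft γ Γ b₀ ⊤ = 1 / (cfRight γ Γ b₀ ⊤ + Γ) := cfLeft_top_eq hγ1 hγΓ hb₀
      _ < 1 / (cfLeft γ Γ b₀ ⊤ + γ) := one_div_lt_one_div_of_lt (by linarith) (by linarith)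
      _ = cfRight γ Γ b₀ ⊤ := (cfRight_top_eq hγ1 hγΓ hb₀).symm
  | coe n => simpa using (cfEndpoints_spec hγ1 hγΓ hb₀ n).2.1

theorem cfInterval_anti (hγ1 : 1 ≤ γ) (hγΓ : γ < Γ) (hb₀ : 1 / γ ≤ b₀) :
    Antitone (cfInterval γ Γ b₀) := fun _ _ h =>
  Set.Icc_subset_Icc (cfLeft_mono hγ1 hγΓ hb₀ h) (cfRight_anti hγ1 hγΓ hb₀ h)

theorem cfLeft_le_cfMap (hγ1 : 1 ≤ γ) (hγΓ : γ < Γ) (hb₀ : 1 / γ ≤ b₀) (k : ℕ∞) :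
    cfLeft γ Γ b₀ k ≤ cfMap Γ (cfRight γ Γ b₀ k) := by
  induction k using ENat.recTopCoe with
  | top => exact (cfLeft_top_eq hγ1 hγΓ hb₀).le
  | coe n =>
    rw [cfLeft_natCast, cfRight_natCast]
    exact (cfEndpoints_spec hγ1 hγΓ hb₀ n).2.2.1

theorem cfMap_le_cfRight (hγ1 : 1 ≤ γ) (hγΓ : γ < Γ) (hb₀ : 1 / γ ≤ b₀) (k : ℕ∞) :
    cfMap γ (cfLeft γ Γ b₀ k) ≤ cfRight γ Γ b₀ k := by
  induction k using ENat.recTopCoe with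
  | top => exact (cfRight_top_eq hγ1 hγΓ hb₀).ge
  | coe n =>
    rw [cfLeft_natCast, cfRight_natCast]
    exact (cfEndpoints_spec hγ1 hγΓ hb₀ n).2.2.2

theorem mapsTo_cfMap (hγ1 : 1 ≤ γ) (hγΓ : γ < Γ) (hb₀ : 1 / γ ≤ b₀) (k : ℕ∞) {β : ℝ}
    (h1 : γ ≤ β) (h2 : β ≤ Γ) :
    Set.MapsTo (cfMap β) (cfInterval γ Γ b₀ k) (cfInterval γ Γ b₀ k) := by
  rintro x ⟨hx1, hx2⟩
  have h0 := cfLeft_nonneg hγ1 hγΓ hb₀ k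
  exact ⟨(cfLeft_le_cfMap hγ1 hγΓ hb₀ k).trans
      (one_div_le_one_div_of_le (by linarith) (by linarith)),
    (one_div_le_one_div_of_le (by linarith) (by linarith)).trans
      (cfMap_le_cfRight hγ1 hγΓ hb₀ k)⟩

end Endpoints

/-! ### The symmetric kernel and its moments. -/

section Kernel

variable {a b : ℝ}

theorem abs_deriv_cfMap_rpow {β x : ℝ} (h : 0 < x + β) (s : ℝ) :
    |deriv (cfMap β) x| ^ s = (x + β) ^ (-(2 * s)) := by
  have h1 : HasDerivAt (cfMap β) (-1 / (x + β) ^ 2) x := by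
    have := ((hasDerivAt_id x).add_const β).fun_inv h.ne'
    have h2 : cfMap β = fun y => (id y + β)⁻¹ := by ext y; simp [cfMap]
    rwa [h2]
  rw [h1.deriv, neg_div, abs_neg, abs_of_pos (by positivity), one_div,
    ← Real.rpow_natCast, ← Real.rpow_neg h.le, ← Real.rpow_mul h.le]
  norm_num

/-- The weighted composition operator dual to `cfTransfer`, on continuous functions on `[a, b]`. -/
noncomputable def cfDualTransfer (B : Finset ℝ) (s : ℝ) (ha : 0 < a) (hB : ∀ β ∈ B, 0 ≤ β)
    (hmaps : ∀ β ∈ B, Set.MapsTo (cfMap β) (Set.Icc a b) (Set.Icc a b)) :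
    C(Set.Icc a b, ℝ) →ₗ[ℝ] C(Set.Icc a b, ℝ) where
  toFun φ :=
    { toFun := fun r => ∑ β ∈ B.attach,
        ((r : ℝ) + β) ^ (-(2 * s)) * φ ⟨cfMap β r, hmaps β β.2 r.2⟩
      continuous_toFun := by
        refine continuous_finsetSum _ fun β _ => ?_
        have hne : ∀ r : Set.Icc a b, (r : ℝ) + β ≠ 0 := fun r => by
          linarith [r.2.1, hB β β.2]
        refine Continuous.mul ?_ (φ.continuous.comp (Continuous.subtype_mk ?_ _))
        · exact (by fun_prop : Continuous fun r : Set.Icc a b => (r : ℝ) + β).rpow_const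
            fun r => Or.inl (hne r)
        · unfold cfMap
          fun_prop (disch := assumption) }
  map_add' φ ψ := by
    ext r
    simp [mul_add, Finset.sum_add_distrib]
  map_smul' c φ := by
    ext r
    simp [Finset.mul_sum, mul_left_comm]

/-- The moments `∫ r ^ j (1 + r x) ^ (-(2 s + j)) dν(r)`. -/
noncomputable def cfMoment (ν : MeasureTheory.Measure (Set.Icc a b)) (s : ℝ) (j : ℕ) (x : ℝ) : ℝ :=
  ∫ r : Set.Icc a b, (r : ℝ) ^ j * (1 + r * x) ^ (-(2 * s + j)) ∂ν

theorem continuous_kernel {x : ℝ} (hx : ∀ r ∈ Set.Icc a b, 0 < 1 + r * x) (j : ℕ) (p : ℝ) :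
    Continuous fun r : Set.Icc a b => (r : ℝ) ^ j * (1 + r * x) ^ p := by
  refine Continuous.mul (by fun_prop) ?_
  exact (by fun_prop : Continuous fun r : Set.Icc a b => 1 + (r : ℝ) * x).rpow_const
    fun r => Or.inl (hx r r.2).ne'

theorem Continuous.integrable_Icc {ν : MeasureTheory.Measure (Set.Icc a b)}
    [MeasureTheory.IsFiniteMeasure ν] {f : Set.Icc a b → ℝ} (hf : Continuous f) :
    MeasureTheory.Integrable f ν :=
  (hf.integrable_of_hasCompactSupport (HasCompactSupport.of_compactSpace f))

theorem kernel_pos (ha : 0 < a) {x : ℝ} (hx : 0 ≤ x) : ∀ r ∈ Set.Icc a b, 0 < 1 + r * x :=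
  fun r hr => by
    have : 0 < r := ha.trans_le hr.1
    positivity

/-- Integrating the kernel symmetry against an eigenmeasure of the dual operator moves `L_s` from
the variable `x` to `r`, where it becomes multiplication by `lam`. The point `x` need not lie in
`[a, b]`, so one measure serves all the intervals. -/
theorem exists_eigen_moment (B : Finset ℝ) (s : ℝ) (ha : 0 < a) (hab : a ≤ b)
    (hB : ∀ β ∈ B, 0 < β)
    (hmaps : ∀ β ∈ B, Set.MapsTo (cfMap β) (Set.Icc a b) (Set.Icc a b)) :
    ∃ (lam : ℝ) (ν : MeasureTheory.Measure (Set.Icc a b)), MeasureTheory.IsFiniteMeasure ν ∧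
      ν ≠ 0 ∧ ∀ x, 0 ≤ x → cfTransfer B s (cfMoment ν s 0) x = lam * cfMoment ν s 0 x := by
  have hne : Nonempty (Set.Icc a b) := ⟨⟨a, le_rfl, hab⟩⟩
  obtain ⟨lam, ν, hfin, hν, heig⟩ := exists_eigenmeasure
    (cfDualTransfer B s ha (fun β hβ => (hB β hβ).le) hmaps) (by
      intro f hf r
      refine Finset.sum_nonneg fun β _ => mul_nonneg (Real.rpow_nonneg ?_ _) (hf _)
      linarith [r.2.1, hB β β.2])
  refine ⟨lam, ν, hfin, hν, fun x hx => ?_⟩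
  have h := heig ⟨_, continuous_kernel (kernel_pos ha hx) 0 (-(2 * s + (0 : ℕ)))⟩
  unfold cfMoment
  refine Eq.trans ?_ h
  unfold cfTransfer
  simp only [cfDualTransfer, LinearMap.coe_mk, AddHom.coe_mk, ContinuousMap.coe_mk]
  rw [← Finset.sum_attach, MeasureTheory.integral_finsetSum]
  · refine Finset.sum_congr rfl fun β _ => ?_
    have hβ := hB β β.2
    rw [abs_deriv_cfMap_rpow (by linarith), ← MeasureTheory.integral_const_mul]
    refine MeasureTheory.integral_congr_ae (Eventually.of_forall fun r => ?_)
    have hr : (0 : ℝ) < r := ha.trans_le r.2.1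
    have h1 : (0 : ℝ) < x + β := by linarith
    have h2 : (0 : ℝ) < r + β := by linarith
    simp only [pow_zero, one_mul, Nat.cast_zero, add_zero, cfMap]
    rw [← Real.mul_rpow (by positivity) (by positivity),
      ← Real.mul_rpow (by positivity) (by positivity)]
    -- Both bases equal `x + β + r`.
    congr 1
    field_simp
    ring
  · intro β _
    refine Continuous.integrable_Icc ?_
    have hβ := hB β β.2
    have hne : ∀ r : Set.Icc a b, (r : ℝ) + β ≠ 0 := fun r => by
      linarith [r.2.1]
    refine Continuous.mul ?_ ?_
    · exact (by fun_prop : Continuous fun r : Set.Icc a b => (r : ℝ) + β).rpow_const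
        fun r => Or.inl (hne r)
    · refine (continuous_kernel (a := a) (b := b) (kernel_pos ha hx) 0 _).comp
        (Continuous.subtype_mk ?_ fun r => hmaps β β.2 r.2)
      unfold cfMap
      fun_prop (disch := assumption)

variable {ν : MeasureTheory.Measure (Set.Icc a b)} [MeasureTheory.IsFiniteMeasure ν]

theorem hasDerivAt_cfMoment (ha : 0 < a) {s : ℝ} (hs : 0 < s) (j : ℕ) {x : ℝ} (hx : 0 ≤ x) :
    HasDerivAt (cfMoment ν s j) (-(2 * s + j) * cfMoment ν s (j + 1) x) x := by
  -- Since `x = 0` is allowed, the neighbourhood must contain negative `y`; this cut-off keeps `1 +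
  -- r y ≥ 1/2` for all `r ≤ |b| + 1`, which makes the dominating constant finite.
  set U : Set ℝ := Set.Ioi (-1 / (2 * (|b| + 1))) with hU
  have hUn : U ∈ 𝓝 x := Ioi_mem_nhds (lt_of_lt_of_le (by
    rw [neg_div]; exact neg_neg_of_pos (by positivity)) hx)
  have hpos : ∀ y ∈ U, ∀ r ∈ Set.Icc a b, 1 / 2 ≤ 1 + r * y := by
    intro y hy r hr
    have h0 : 0 < r := ha.trans_le hr.1
    have h1 : r ≤ |b| + 1 := by linarith [hr.2, le_abs_self b]
    have h2 : -1 / (2 * (|b| + 1)) < y := hy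
    rw [div_lt_iff₀ (by positivity)] at h2
    rcases le_or_gt 0 y with h | h
    · nlinarith [mul_nonneg h0.le h]
    · nlinarith
  have hpos' : ∀ y ∈ U, ∀ r ∈ Set.Icc a b, 0 < 1 + r * y := fun y hy r hr =>
    lt_of_lt_of_le (by norm_num) (hpos y hy r hr)
  have key := hasDerivAt_integral_of_dominated_loc_of_deriv_le (μ := ν) (x₀ := x) (s := U)
    (F := fun (y : ℝ) (r : Set.Icc a b) => (r : ℝ) ^ j * (1 + r * y) ^ (-(2 * s + j)))
    (F' := fun (y : ℝ) (r : Set.Icc a b) =>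
      -(2 * s + j) * ((r : ℝ) ^ (j + 1) * (1 + r * y) ^ (-(2 * s + ((j + 1 : ℕ) : ℝ)))))
    (bound := fun _ =>
      (2 * s + j) * (|b| ^ (j + 1) * (1 / 2) ^ (-(2 * s + ((j + 1 : ℕ) : ℝ)))))
    hUn
    (by
      filter_upwards [hUn] with y hy
      exact (continuous_kernel (hpos' y hy) j _).aestronglyMeasurable)
    (continuous_kernel (kernel_pos ha hx) j _).integrable_Icc
    ((continuous_kernel (kernel_pos ha hx) (j + 1) _).const_mul _).aestronglyMeasurable
    (Eventually.of_forall fun r y hy => by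
      have hr : (0 : ℝ) < r := ha.trans_le r.2.1
      have h1 := hpos y hy r r.2
      have h2 : 0 < 1 + (r : ℝ) * y := hpos' y hy r r.2
      rw [Real.norm_eq_abs, abs_mul, abs_neg, abs_of_pos (by positivity : 0 < 2 * s + j),
        abs_of_pos (by positivity)]
      gcongr ?_ * (?_ ^ _ * ?_)
      · exact r.2.2.trans (le_abs_self b)
      · exact Real.rpow_le_rpow_of_nonpos (by norm_num) h1
          (neg_nonpos.2 (by positivity)))
    (MeasureTheory.integrable_const _)
    (Eventually.of_forall fun r y hy => by
      have h2 : 0 < 1 + (r : ℝ) * y := hpos' y hy r r.2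
      have h3 : HasDerivAt (fun y : ℝ => 1 + (r : ℝ) * y) (r : ℝ) y := by
        simpa using ((hasDerivAt_id y).const_mul (r : ℝ)).const_add 1
      have h4 := (h3.rpow_const (p := -(2 * s + j)) (Or.inl h2.ne')).const_mul ((r : ℝ) ^ j)
      refine h4.congr_deriv ?_
      have : -(2 * s + (j : ℝ)) - 1 = -(2 * s + ((j + 1 : ℕ) : ℝ)) := by push_cast; ring
      rw [this]
      ring)
  rw [MeasureTheory.integral_const_mul] at key
  exact key.2

theorem cfMoment_pos (ha : 0 < a) (hν : ν ≠ 0) (s : ℝ) (j : ℕ) {x : ℝ} (hx : 0 ≤ x) :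
    0 < cfMoment ν s j x := by
  have hpos : ∀ r : Set.Icc a b, 0 < (r : ℝ) ^ j * (1 + r * x) ^ (-(2 * s + j)) := fun r => by
    have h1 : (0 : ℝ) < r := ha.trans_le r.2.1
    positivity
  unfold cfMoment
  rw [MeasureTheory.integral_pos_iff_support_of_nonneg (fun r => (hpos r).le)
    (continuous_kernel (kernel_pos ha hx) j _).integrable_Icc]
  rw [show Function.support _ = Set.univ from Set.eq_univ_of_forall fun r => (hpos r).ne']
  exact MeasureTheory.Measure.measure_univ_pos.2 hν

/-- The integrand of order `j` is that of order `0` divided by `(x + 1/r)^j`, because `(1 + r x) / r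
= x + 1/r`; both bounds then hold for each `r` before integration. -/
theorem cfMoment_bounds (ha : 0 < a) (s : ℝ) (j : ℕ) {x p q : ℝ} (hp : 0 ≤ p)
    (hx : x ∈ Set.Icc p q) :
    cfMoment ν s 0 x / (q + a⁻¹) ^ j ≤ cfMoment ν s j x ∧
      cfMoment ν s j x ≤ cfMoment ν s 0 x / (p + b⁻¹) ^ j := by
  have hx0 : 0 ≤ x := hp.trans hx.1
  have hkey : ∀ r : Set.Icc a b, (r : ℝ) ^ j * (1 + r * x) ^ (-(2 * s + j)) =
      (1 + r * x) ^ (-(2 * s + (0 : ℕ))) / (x + (r : ℝ)⁻¹) ^ j := fun r => by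
    have h1 : (0 : ℝ) < r := ha.trans_le r.2.1
    have h2 : 0 < 1 + (r : ℝ) * x := kernel_pos ha hx0 r r.2
    rw [neg_add, Real.rpow_add h2, Real.rpow_neg h2.le (j : ℝ), Real.rpow_natCast,
      show x + (r : ℝ)⁻¹ = (1 + r * x) / r by field_simp; ring, div_pow]
    simp only [Nat.cast_zero, add_zero]
    field_simp
  have hi : ∀ i : ℕ, MeasureTheory.Integrable
      (fun r : Set.Icc a b => (r : ℝ) ^ i * (1 + r * x) ^ (-(2 * s + i))) ν := fun i =>
    (continuous_kernel (kernel_pos ha hx0) i _).integrable_Icc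
  unfold cfMoment
  constructor
  · rw [← MeasureTheory.integral_div]
    refine MeasureTheory.integral_mono ((hi 0).div_const _) (hi j) fun r => ?_
    have h1 : (0 : ℝ) < r := ha.trans_le r.2.1
    have h2 : 0 < 1 + (r : ℝ) * x := kernel_pos ha hx0 r r.2
    simp only [hkey r, pow_zero, one_mul]
    gcongr
    · exact hx.2
    · exact r.2.1
  · rw [← MeasureTheory.integral_div]
    refine MeasureTheory.integral_mono (hi j) ((hi 0).div_const _) fun r => ?_
    have h1 : (0 : ℝ) < r := ha.trans_le r.2.1
    have h2 : 0 < 1 + (r : ℝ) * x := kernel_pos ha hx0 r r.2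
    have h3 : 0 < b := h1.trans_le r.2.2
    simp only [hkey r, pow_zero, one_mul]
    gcongr
    · exact hx.1
    · exact r.2.2

/-- The kernels at `x` and `y` are compared for each fixed `r`, so no differentiation is needed. -/
theorem cfMoment_le_mul_exp (ha : 0 < a) (hab : a ≤ b) {s : ℝ} (hs : 0 < s) {x y p : ℝ}
    (hp : 0 ≤ p) (hx : p ≤ x) (hy : p ≤ y) :
    cfMoment ν s 0 x ≤ cfMoment ν s 0 y * Real.exp (2 * s * |x - y| / (p + b⁻¹)) := by
  have hx0 : 0 ≤ x := hp.trans hx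
  have hy0 : 0 ≤ y := hp.trans hy
  have hb : 0 < b := ha.trans_le hab
  unfold cfMoment
  rw [← MeasureTheory.integral_mul_const]
  refine MeasureTheory.integral_mono (continuous_kernel (kernel_pos ha hx0) 0 _).integrable_Icc
    ((continuous_kernel (kernel_pos ha hy0) 0 _).integrable_Icc.mul_const _) fun r => ?_
  have h1 : (0 : ℝ) < r := ha.trans_le r.2.1
  have h2 : 0 < 1 + (r : ℝ) * x := kernel_pos ha hx0 r r.2
  have h3 : 0 < 1 + (r : ℝ) * y := kernel_pos ha hy0 r r.2
  have h4 : 0 < p + b⁻¹ := by positivity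
  set t := |x - y| / (p + b⁻¹)
  -- From `r ≤ b` and `p ≤ x`, `r (p + 1/b) ≤ 1 + r x`, so `r |x - y| ≤ (1 + r x) t`; then `1 + t ≤
  -- exp t`.
  have h5 : 1 + (r : ℝ) * y ≤ (1 + r * x) * Real.exp t := by
    have h6 : (r : ℝ) * (p + b⁻¹) ≤ 1 + r * x := by
      have : (r : ℝ) * b⁻¹ ≤ 1 := by
        rw [← div_eq_mul_inv, div_le_one hb]; exact r.2.2
      nlinarith
    have h7 : t * (p + b⁻¹) = |x - y| := div_mul_cancel₀ _ h4.ne'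
    have h8 : (r : ℝ) * |x - y| ≤ (1 + r * x) * t := by
      rw [← h7]
      have : 0 ≤ t := by positivity
      nlinarith
    have h9 : (r : ℝ) * (y - x) ≤ r * |x - y| :=
      mul_le_mul_of_nonneg_left (by rw [abs_sub_comm]; exact le_abs_self _) h1.le
    have := mul_le_mul_of_nonneg_left (Real.add_one_le_exp t) h2.le
    nlinarith
  simp only [pow_zero, one_mul, Nat.cast_zero, add_zero]
  have h6 := Real.rpow_le_rpow_of_nonpos h3 h5 (neg_nonpos.2 (by positivity : 0 ≤ 2 * s))
  rw [Real.mul_rpow h2.le (Real.exp_pos _).le, ← Real.exp_mul] at h6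
  have h7 : 2 * s * |x - y| / (p + b⁻¹) = - (t * -(2 * s)) := by
    simp only [t]; ring
  rw [h7, Real.exp_neg, ← div_eq_mul_inv, le_div_iff₀ (Real.exp_pos _)]
  exact h6

theorem iteratedDerivWithin_cfMoment (ha : 0 < a) {s : ℝ} (hs : 0 < s) {p q : ℝ} (hp : 0 ≤ p)
    (hpq : p < q) (j : ℕ) : ∀ x ∈ Set.Icc p q,
    iteratedDerivWithin j (cfMoment ν s 0) (Set.Icc p q) x =
      (-1) ^ j * (∏ i ∈ Finset.range j, (2 * s + (i : ℝ))) * cfMoment ν s j x := by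
  induction j with
  | zero => intro x _; simp
  | succ j ih =>
    intro x hx
    rw [iteratedDerivWithin_succ, derivWithin_congr ih (ih x hx)]
    have h := ((hasDerivAt_cfMoment (ν := ν) ha hs j (hp.trans hx.1)).const_mul
      ((-1) ^ j * (∏ i ∈ Finset.range j, (2 * s + (i : ℝ))))).hasDerivWithinAt.derivWithin
      (uniqueDiffOn_Icc hpq x hx)
    rw [h, Finset.prod_range_succ]
    ring

theorem contDiffOn_cfMoment (ha : 0 < a) {s : ℝ} (hs : 0 < s) {p q : ℝ} (hp : 0 ≤ p)
    (hpq : p < q) : ContDiffOn ℝ ∞ (cfMoment ν s 0) (Set.Icc p q) := by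
  refine contDiffOn_of_differentiableOn_deriv fun m _ => ?_
  refine DifferentiableOn.congr (fun x hx => ?_) (iteratedDerivWithin_cfMoment ha hs hp hpq m)
  exact ((hasDerivAt_cfMoment ha hs m (hp.trans hx.1)).const_mul
    _).differentiableAt.differentiableWithinAt

end Kernel

/-! ### Uniqueness of the positive eigenfunction. -/

section Uniqueness

/-- If `w ≤ c v` on `S`, with equality at `x`, then the eigenvalues are ordered; if the reverse
order holds too, equality propagates along each branch. -/
theorem eigen_touching {B : Finset ℝ} {s : ℝ} {S : Set ℝ} {v w : ℝ → ℝ} {lam μ c : ℝ}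
    (hS : ∀ x ∈ S, ∀ β ∈ B, 0 < x + β)
    (hmaps : ∀ β ∈ B, Set.MapsTo (cfMap β) S S) (hw : ∀ x ∈ S, 0 < w x)
    (hlv : ∀ x ∈ S, cfTransfer B s v x = lam * v x)
    (hlw : ∀ x ∈ S, cfTransfer B s w x = μ * w x)
    (hle : ∀ x ∈ S, w x ≤ c * v x) {x : ℝ} (hx : x ∈ S) (heq : w x = c * v x) :
    μ ≤ lam ∧ (lam ≤ μ → ∀ β ∈ B, w (cfMap β x) = c * v (cfMap β x)) := by
  have hterm : ∀ β ∈ B, |deriv (cfMap β) x| ^ s * w (cfMap β x) ≤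
      c * (|deriv (cfMap β) x| ^ s * v (cfMap β x)) := fun β hβ => by
    rw [mul_left_comm]
    exact mul_le_mul_of_nonneg_left (hle _ (hmaps β hβ hx)) (by positivity)
  have h1 : c * cfTransfer B s v x = lam * w x := by rw [hlv x hx, heq]; ring
  have hsum : cfTransfer B s w x ≤ c * cfTransfer B s v x := by
    unfold cfTransfer
    rw [Finset.mul_sum]
    exact Finset.sum_le_sum hterm
  refine ⟨?_, fun hlm β hβ => ?_⟩
  · rw [h1, hlw x hx] at hsum
    exact le_of_mul_le_mul_right hsum (hw x hx)
  · have h2 : c * cfTransfer B s v x ≤ cfTransfer B s w x := by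
      rw [h1, hlw x hx]
      exact mul_le_mul_of_nonneg_right hlm (hw x hx).le
    have h3 := le_antisymm hsum h2
    unfold cfTransfer at h3
    rw [Finset.mul_sum] at h3
    have h4 := (Finset.sum_eq_sum_iff_of_le hterm).1 h3 β hβ
    rw [mul_left_comm, abs_deriv_cfMap_rpow (hS x hx β hβ)] at h4
    exact mul_left_cancel₀ (Real.rpow_pos_of_pos (hS x hx β hβ) _).ne' h4

theorem dist_cfMap_le {β x y : ℝ} (hβ : 1 ≤ β) (hx : 0 ≤ x) (hy : 0 ≤ y) :
    dist (cfMap β x) (cfMap β y) ≤ 1 / β * dist x y := by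
  have h1 : 0 < x + β := by linarith
  have h2 : 0 < y + β := by linarith
  have h3 : β ≤ (x + β) * (y + β) := by nlinarith
  unfold cfMap
  rw [Real.dist_eq, Real.dist_eq, div_sub_div _ _ h1.ne' h2.ne', abs_div,
    abs_of_pos (mul_pos h1 h2), one_div_mul_eq_div,
    show 1 * (y + β) - (x + β) * 1 = -(x - y) by ring, abs_neg]
  gcongr

theorem tendsto_dist_iterate_cfMap {β : ℝ} (hβ : 1 < β) {S : Set ℝ} (hS : ∀ x ∈ S, 0 ≤ x)
    (hmaps : Set.MapsTo (cfMap β) S S) {x y : ℝ} (hx : x ∈ S) (hy : y ∈ S) :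
    Tendsto (fun n => dist ((cfMap β)^[n] x) ((cfMap β)^[n] y)) atTop (𝓝 0) := by
  have hbound : ∀ n, dist ((cfMap β)^[n] x) ((cfMap β)^[n] y) ≤ (1 / β) ^ n * dist x y := by
    intro n
    induction n with
    | zero => simp
    | succ n ih =>
      rw [Function.iterate_succ_apply', Function.iterate_succ_apply', pow_succ', mul_assoc]
      exact (dist_cfMap_le hβ.le (hS _ (hmaps.iterate n hx)) (hS _ (hmaps.iterate n hy))).trans
        (mul_le_mul_of_nonneg_left ih (by positivity))
  refine squeeze_zero (fun _ => dist_nonneg) hbound ?_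
  have := (tendsto_pow_atTop_nhds_zero_of_lt_one (by positivity : 0 ≤ 1 / β)
    ((div_lt_one (by linarith)).2 hβ)).mul_const (dist x y)
  simpa using this

/-- Touching at the maximum and at the minimum of `w / v` forces the two eigenvalues to agree. The
extreme values `c` and `d` then persist along the `θ_Γ`-orbits of the extremal points. These orbits
approach each other, so uniform continuity of `w / v` gives `c = d`. The branch `Γ` is used because
`Γ > 1` makes it a contraction, whereas `γ` may equal `1`. -/
theorem eigenfunction_unique {B : Finset ℝ} {s : ℝ} {S : Set ℝ} {v w : ℝ → ℝ}
    (hSc : IsCompact S) (hSne : S.Nonempty) (hS0 : ∀ x ∈ S, 0 ≤ x) (hB : ∀ β ∈ B, 0 < β)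
    (hmaps : ∀ β ∈ B, Set.MapsTo (cfMap β) S S) {Γ : ℝ} (hΓ : Γ ∈ B) (hΓ1 : 1 < Γ)
    (hv : IsPosEigenfunction B s S v) (hw : IsPosEigenfunction B s S w) :
    ∃ c : ℝ, 0 < c ∧ ∀ x ∈ S, w x = c * v x := by
  obtain ⟨lam, hlv⟩ := hv.eigen
  obtain ⟨μ, hlw⟩ := hw.eigen
  have hS : ∀ x ∈ S, ∀ β ∈ B, 0 < x + β := fun x hx β hβ => by
    linarith [hS0 x hx, hB β hβ]
  have hcont : ContinuousOn (fun x => w x / v x) S :=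
    hw.continuousOn.div hv.continuousOn fun x hx => (hv.pos x hx).ne'
  obtain ⟨x₀, hx₀, hmax⟩ := hSc.exists_isMaxOn hSne hcont
  obtain ⟨y₀, hy₀, hmin⟩ := hSc.exists_isMinOn hSne hcont
  set c := w x₀ / v x₀ with hc
  set d := w y₀ / v y₀ with hd
  have hc0 : 0 < c := div_pos (hw.pos _ hx₀) (hv.pos _ hx₀)
  have hd0 : 0 < d := div_pos (hw.pos _ hy₀) (hv.pos _ hy₀)
  have hle : ∀ x ∈ S, w x ≤ c * v x := fun x hx =>
    (div_le_iff₀ (hv.pos x hx)).1 (hmax hx)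
  have hge : ∀ x ∈ S, v x ≤ d⁻¹ * w x := fun x hx => by
    rw [inv_mul_eq_div, le_div_iff₀ hd0, mul_comm]
    exact (le_div_iff₀ (hv.pos x hx)).1 (hmin hx)
  have hcx : w x₀ = c * v x₀ := (div_mul_cancel₀ _ (hv.pos _ hx₀).ne').symm
  have hdy : v y₀ = d⁻¹ * w y₀ := by
    rw [inv_mul_eq_div, eq_div_iff hd0.ne', mul_comm]
    exact div_mul_cancel₀ _ (hv.pos _ hy₀).ne'
  have h1 : μ ≤ lam := (eigen_touching hS hmaps hw.pos hlv hlw hle hx₀ hcx).1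
  have h2 : lam ≤ μ := (eigen_touching hS hmaps hv.pos hlw hlv hge hy₀ hdy).1
  have hSΓ := hmaps Γ hΓ
  have hxn : ∀ n, w ((cfMap Γ)^[n] x₀) = c * v ((cfMap Γ)^[n] x₀) := by
    intro n
    induction n with
    | zero => exact hcx
    | succ n ih =>
      rw [Function.iterate_succ_apply']
      exact (eigen_touching hS hmaps hw.pos hlv hlw hle (hSΓ.iterate n hx₀) ih).2 h2 Γ hΓ
  have hyn : ∀ n, v ((cfMap Γ)^[n] y₀) = d⁻¹ * w ((cfMap Γ)^[n] y₀) := by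
    intro n
    induction n with
    | zero => exact hdy
    | succ n ih =>
      rw [Function.iterate_succ_apply']
      exact (eigen_touching hS hmaps hv.pos hlw hlv hge (hSΓ.iterate n hy₀) ih).2 h1 Γ hΓ
  have hcd : c = d := by
    have huc := hSc.uniformContinuousOn_of_continuous hcont
    rw [← dist_le_zero]
    refine le_of_forall_pos_le_add fun ε hε => ?_
    obtain ⟨δ, hδ, huc⟩ := Metric.uniformContinuousOn_iff.1 huc ε hε
    obtain ⟨n, hn⟩ := ((tendsto_dist_iterate_cfMap hΓ1 hS0 hSΓ hx₀ hy₀).eventually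
      (gt_mem_nhds hδ)).exists
    have hxS := hSΓ.iterate n hx₀
    have hyS := hSΓ.iterate n hy₀
    have h := huc _ hxS _ hyS hn
    rw [hxn n, mul_div_cancel_right₀ _ (hv.pos _ hxS).ne', hyn n, div_mul_eq_div_div_swap,
      div_self (hw.pos _ hyS).ne', one_div, inv_inv] at h
    linarith
  refine ⟨c, hc0, fun x hx => le_antisymm (hle x hx) ?_⟩
  have := hge x hx
  rwa [inv_mul_eq_div, le_div_iff₀ hd0, mul_comm, ← hcd] at this

end Uniqueness

/-! ### Assembly on the intervals `[a_l, b_l]`. -/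

/-- The positive eigenfunction is, on every invariant interval, a positive multiple of a
moment function `∫ (1 + r x) ^ (-2 s) dν(r)` with `ν` carried by `[a_∞, b_∞]`. -/
theorem exists_eigenmeasure_cfInterval {B : Finset ℝ} {γ Γ b₀ : ℝ}
    (hγ : IsLeast (B : Set ℝ) γ) (hΓ : IsGreatest (B : Set ℝ) Γ) (hγ1 : 1 ≤ γ) (hγΓ : γ < Γ)
    (hb₀ : 1 / γ ≤ b₀) {s : ℝ} (hs : 0 < s) :
    ∃ ν : MeasureTheory.Measure (Set.Icc (cfLeft γ Γ b₀ ⊤) (cfRight γ Γ b₀ ⊤)),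
      MeasureTheory.IsFiniteMeasure ν ∧ ν ≠ 0 ∧
      ∀ l, IsPosEigenfunction B s (cfInterval γ Γ b₀ l) (cfMoment ν s 0) := by
  have ha := cfLeft_top_pos hγ1 hγΓ hb₀
  obtain ⟨lam, ν, hfin, hν, heig⟩ := exists_eigen_moment (a := cfLeft γ Γ b₀ ⊤)
    (b := cfRight γ Γ b₀ ⊤) B s ha (cfLeft_lt_cfRight hγ1 hγΓ hb₀ ⊤).le
    (fun β hβ => by linarith [hγ.2 hβ])
    (fun β hβ => mapsTo_cfMap hγ1 hγΓ hb₀ ⊤ (hγ.2 hβ) (hΓ.2 hβ))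
  refine ⟨ν, hfin, hν, fun l => ?_⟩
  have h0 : ∀ x ∈ cfInterval γ Γ b₀ l, 0 ≤ x := fun x hx =>
    (cfLeft_nonneg hγ1 hγΓ hb₀ l).trans hx.1
  exact ⟨fun x hx => (hasDerivAt_cfMoment ha hs 0 (h0 x hx)).continuousAt.continuousWithinAt,
    fun x hx => cfMoment_pos ha hν s 0 (h0 x hx), lam, fun x hx => heig x (h0 x hx)⟩

theorem posEigenfunction_cfInterval_unique {B : Finset ℝ} {γ Γ b₀ : ℝ}
    (hγ : IsLeast (B : Set ℝ) γ) (hΓ : IsGreatest (B : Set ℝ) Γ) (hγ1 : 1 ≤ γ) (hγΓ : γ < Γ)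
    (hb₀ : 1 / γ ≤ b₀) {s : ℝ} {l : ℕ∞} {v w : ℝ → ℝ}
    (hv : IsPosEigenfunction B s (cfInterval γ Γ b₀ l) v)
    (hw : IsPosEigenfunction B s (cfInterval γ Γ b₀ l) w) :
    ∃ c : ℝ, 0 < c ∧ ∀ x ∈ cfInterval γ Γ b₀ l, w x = c * v x :=
  eigenfunction_unique isCompact_Icc
    (Set.nonempty_Icc.2 (cfLeft_lt_cfRight hγ1 hγΓ hb₀ l).le)
    (fun _ hx => (cfLeft_nonneg hγ1 hγΓ hb₀ l).trans hx.1)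
    (fun β hβ => by linarith [hγ.2 hβ])
    (fun β hβ => mapsTo_cfMap hγ1 hγΓ hb₀ l (hγ.2 hβ) (hΓ.2 hβ))
    hΓ.1 (by linarith) hv hw

theorem lemma7 (B : Finset ℝ) (γ Γ : ℝ) (hγ : IsLeast (B : Set ℝ) γ)
    (hΓ : IsGreatest (B : Set ℝ) Γ) (hγ1 : 1 ≤ γ) (hγΓ : γ < Γ)
    (b₀ : ℝ) (hb₀ : 1 / γ ≤ b₀) (s : ℝ) (hs : 0 < s) :
    -- the limits `a_∞`, `b_∞` exist, `a_∞ > 0`, and the intervals are nested, nondegenerate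
    -- and invariant
    Tendsto (fun n : ℕ => cfLeft γ Γ b₀ n) atTop (𝓝 (cfLeft γ Γ b₀ ⊤)) ∧
    Tendsto (fun n : ℕ => cfRight γ Γ b₀ n) atTop (𝓝 (cfRight γ Γ b₀ ⊤)) ∧
    0 < cfLeft γ Γ b₀ ⊤ ∧
    (∀ k : ℕ∞, cfLeft γ Γ b₀ k < cfRight γ Γ b₀ k) ∧
    (∀ l k : ℕ∞, l ≤ k → cfInterval γ Γ b₀ k ⊆ cfInterval γ Γ b₀ l) ∧
    (∀ k : ℕ∞, ∀ β ∈ B, Set.MapsTo (cfMap β) (cfInterval γ Γ b₀ k) (cfInterval γ Γ b₀ k)) ∧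
    -- existence and uniqueness up to normalization of `v_s` on `[a_l, b_l]`, `0 ≤ l ≤ ∞`
    (∀ l : ℕ∞, ∃ v : ℝ → ℝ, IsPosEigenfunction B s (cfInterval γ Γ b₀ l) v) ∧
    (∀ (l : ℕ∞) (v w : ℝ → ℝ), IsPosEigenfunction B s (cfInterval γ Γ b₀ l) v →
      IsPosEigenfunction B s (cfInterval γ Γ b₀ l) w →
      ∃ c : ℝ, 0 < c ∧ ∀ x ∈ cfInterval γ Γ b₀ l, w x = c * v x) ∧
    -- the estimates; `l = 0` is the case of `v_s` on `[a_0, b_0]`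
    ∀ (l : ℕ∞) (v : ℝ → ℝ), IsPosEigenfunction B s (cfInterval γ Γ b₀ l) v →
      ContDiffOn ℝ ∞ v (cfInterval γ Γ b₀ l) ∧
      ∀ k : ℕ∞, l ≤ k →
        (∀ j : ℕ, 1 ≤ j → ∀ x ∈ cfInterval γ Γ b₀ k,
          (∏ i ∈ Finset.range j, (2 * s + (i : ℝ))) /
              (cfRight γ Γ b₀ k + (cfLeft γ Γ b₀ ⊤)⁻¹) ^ j
            ≤ (-1) ^ j * iteratedDerivWithin j v (cfInterval γ Γ b₀ l) x / v x ∧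
          (-1) ^ j * iteratedDerivWithin j v (cfInterval γ Γ b₀ l) x / v x
            ≤ (∏ i ∈ Finset.range j, (2 * s + (i : ℝ))) /
              (cfLeft γ Γ b₀ k + (cfRight γ Γ b₀ ⊤)⁻¹) ^ j) ∧
        ∀ χ : ℝ, χ = cfLeft γ Γ b₀ k + (cfRight γ Γ b₀ ⊤)⁻¹ →
          ∀ x₁ ∈ cfInterval γ Γ b₀ k, ∀ x₂ ∈ cfInterval γ Γ b₀ k,
            v x₁ ≤ v x₂ * Real.exp (2 * s * |x₁ - x₂| / χ) ∧
            |Real.log (v x₁) - Real.log (v x₂)| ≤ 2 * s / χ * |x₁ - x₂| := by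
  have ha := cfLeft_top_pos hγ1 hγΓ hb₀
  have hab := cfLeft_lt_cfRight hγ1 hγΓ hb₀ ⊤
  obtain ⟨ν, hfin, hν, heig⟩ := exists_eigenmeasure_cfInterval hγ hΓ hγ1 hγΓ hb₀ hs
  refine ⟨tendsto_cfLeft hγ1 hγΓ hb₀, tendsto_cfRight hγ1 hγΓ hb₀, ha,
    cfLeft_lt_cfRight hγ1 hγΓ hb₀, fun l k h => cfInterval_anti hγ1 hγΓ hb₀ h,
    fun k β hβ => mapsTo_cfMap hγ1 hγΓ hb₀ k (hγ.2 hβ) (hΓ.2 hβ),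
    fun l => ⟨_, heig l⟩,
    fun l v w hv hw => posEigenfunction_cfInterval_unique hγ hΓ hγ1 hγΓ hb₀ hv hw,
    fun l v hv => ?_⟩
  -- Smoothness and both estimates are invariant under positive scaling, so they pass from the
  -- moment function to `v`.
  obtain ⟨c, hc, hvc⟩ := posEigenfunction_cfInterval_unique hγ hΓ hγ1 hγΓ hb₀ (heig l) hv
  have hl0 := cfLeft_nonneg hγ1 hγΓ hb₀ l
  have hl := cfLeft_lt_cfRight hγ1 hγΓ hb₀ l
  refine ⟨(contDiffOn_const.mul (contDiffOn_cfMoment ha hs hl0 hl)).congr hvc,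
    fun k hlk => ?_⟩
  have hsub := cfInterval_anti hγ1 hγΓ hb₀ hlk
  have hk0 := cfLeft_nonneg hγ1 hγΓ hb₀ k
  constructor
  · intro j _ x hx
    have hxl := hsub hx
    have hm := cfMoment_pos ha hν s 0 (hk0.trans hx.1)
    have hP : 0 ≤ ∏ i ∈ Finset.range j, (2 * s + (i : ℝ)) :=
      Finset.prod_nonneg fun i _ => by positivity
    have hratio : (-1) ^ j * iteratedDerivWithin j v (cfInterval γ Γ b₀ l) x / v x =
        (∏ i ∈ Finset.range j, (2 * s + (i : ℝ))) * (cfMoment ν s j x / cfMoment ν s 0 x) := by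
      rw [iteratedDerivWithin_congr hvc hxl, iteratedDerivWithin_const_mul_field, hvc x hxl,
        cfInterval, iteratedDerivWithin_cfMoment ha hs hl0 hl j x hxl]
      have h1 : ((-1 : ℝ) ^ j) * (-1) ^ j = 1 := by rw [← mul_pow]; norm_num
      field_simp
      linear_combination cfMoment ν s j x * h1
    obtain ⟨h1, h2⟩ := cfMoment_bounds (ν := ν) ha s j hk0 hx
    rw [hratio, div_eq_mul_one_div (∏ i ∈ Finset.range j, (2 * s + (i : ℝ))),
      div_eq_mul_one_div (∏ i ∈ Finset.range j, (2 * s + (i : ℝ)))]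
    refine ⟨mul_le_mul_of_nonneg_left ?_ hP, mul_le_mul_of_nonneg_left ?_ hP⟩
    · rwa [le_div_iff₀ hm, one_div_mul_eq_div]
    · rwa [div_le_iff₀ hm, one_div_mul_eq_div]
  · rintro χ rfl
    have hexp : ∀ x₁ ∈ cfInterval γ Γ b₀ k, ∀ x₂ ∈ cfInterval γ Γ b₀ k,
        v x₁ ≤ v x₂ * Real.exp (2 * s * |x₁ - x₂| /
          (cfLeft γ Γ b₀ k + (cfRight γ Γ b₀ ⊤)⁻¹)) := fun x₁ h₁ x₂ h₂ => by
      rw [hvc x₁ (hsub h₁), hvc x₂ (hsub h₂), mul_assoc]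
      exact mul_le_mul_of_nonneg_left
        (cfMoment_le_mul_exp ha hab.le hs hk0 h₁.1 h₂.1) hc.le
    have hlog : ∀ x₁ ∈ cfInterval γ Γ b₀ k, ∀ x₂ ∈ cfInterval γ Γ b₀ k,
        Real.log (v x₁) - Real.log (v x₂) ≤
          2 * s / (cfLeft γ Γ b₀ k + (cfRight γ Γ b₀ ⊤)⁻¹) * |x₁ - x₂| :=
      fun x₁ h₁ x₂ h₂ => by
      have h := Real.log_le_log (hv.pos _ (hsub h₁)) (hexp x₁ h₁ x₂ h₂)
      rw [Real.log_mul (hv.pos _ (hsub h₂)).ne' (Real.exp_pos _).ne', Real.log_exp] at h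
      rw [div_mul_eq_mul_div]
      linarith
    refine fun x₁ h₁ x₂ h₂ => ⟨hexp x₁ h₁ x₂ h₂, abs_le.2 ⟨?_, hlog x₁ h₁ x₂ h₂⟩⟩
    have := hlog x₂ h₂ x₁ h₁
    rw [abs_sub_comm] at this
    linarith
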